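/- Let $d, T, M$ be natural numbers, let $\boldsymbol\Sigma_0 \in \mathbb{R}^{d\times d}$ be symmetric positive definite, $\sigma > 0$, and $x_1,\dots,x_T \in \mathbb{R}^d$ fixed vectors. Let $$\boldsymbol\Sigma = \Big(\boldsymbol\Sigma_0^{-1} + \frac{1}{\sigma^2}\sum_{t=1}^T x_t x_t^\top\Big)^{-1}.$$ Let $\mathbf{Z}_0$ be a random $d\times M$ matrix and $\mathbf{z}_1,\dots,\mathbf{z}_T$ random vectors in $\mathbb{R}^M$ such that the $d$ rows of $\mathbf{Z}_0$ together with $\mathbf{z}_1,\dots,\mathbf{z}_T$ are $d+T$ mutually independent random vectors, each uniformly distributed on the unit sphere of $\mathbb{R}^M$. Define the $d \times M$ matrix $$\mathbf{A} = \boldsymbol\Sigma\Big(\boldsymbol\Sigma_0^{-1/2}\mathbf{Z}_0 + \frac1\sigma\sum_{t=1}^T x_t\mathbf{z}_t^\top\Big),$$ where $\boldsymbol\Sigma_0^{-1/2}$ is the symmetric positive definite square root of $\boldsymbol\Sigma_0^{-1}$. Let $\varepsilon,\delta\in(0,1)$. (a) If $M \ge 64\,\varepsilon^{-2}\big(d\log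 9 + \log(2/\delta)\big)$, then with probability at least $1-\delta$, $$(1-\varepsilon)\,x^\top\boldsymbol\Sigma x \le x^\top \mathbf{A}\mathbf{A}^\top x \le (1+\varepsilon)\,x^\top\boldsymbol\Sigma x$$ simultaneously for all $x\in\mathbb{R}^d$ with $\|x\|=1$. (b) If $\mathcal{X}\subset\mathbb{R}^d$ is a finite set and $M \ge 64\,\varepsilon^{-2}\log(2|\mathcal{X}|/\delta)$, then with probability at least $1-\delta$ the same two inequalities hold simultaneously for all $x\in\mathcal{X}$. -/

import Mathlib

open MeasureTheory ProbabilityTheory Matrix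
open scoped MatrixOrder

noncomputable section

namespace Hypermodel

/-- The uniform distribution on the unit sphere of `ℝ^m`, as a measure on `ℝ^m`: the surface
measure of the sphere, normalized to total mass one. -/
def uniformSphere (m : ℕ) : Measure (EuclideanSpace ℝ (Fin m)) :=
  (ProbabilityTheory.cond (volume : Measure (EuclideanSpace ℝ (Fin m))).toSphere Set.univ).map
    (Subtype.val : Metric.sphere (0 : EuclideanSpace ℝ (Fin m)) 1 → EuclideanSpace ℝ (Fin m))

/-- The random vectors `z i` are independent and each is uniformly distributed on the unit sphere
of `ℝ^m`. -/
structure IsSpherical {Ω ι : Type*} [MeasurableSpace Ω] {m : ℕ} (P : Measure Ω)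
    (z : ι → Ω → EuclideanSpace ℝ (Fin m)) : Prop where
  hasLaw : ∀ i, HasLaw (z i) (uniformSphere m) P
  indep : iIndepFun z P

/-- The posterior covariance matrix `Σ = (Σ₀⁻¹ + σ⁻² ∑ₜ xₜ xₜᵀ)⁻¹`. -/
def posteriorCov {d T : ℕ} (S₀ : Matrix (Fin d) (Fin d) ℝ) (σ : ℝ)
    (x : Fin T → EuclideanSpace ℝ (Fin d)) : Matrix (Fin d) (Fin d) ℝ :=
  (S₀⁻¹ + (1 / σ ^ 2) • ∑ t, vecMulVec (x t).ofLp (x t).ofLp)⁻¹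

/-- The factor `A = Σ (Σ₀^{-1/2} Z₀ + σ⁻¹ ∑ₜ xₜ zₜᵀ)`, a `d × M` matrix. The rows of `Z₀` are given
as a family of vectors of `ℝ^M`, and `Σ₀^{-1/2}` is the power of the continuous functional
calculus, that is, the inverse of the positive square root of a positive definite `Σ₀`. -/
def factor {d T M : ℕ} (S₀ : Matrix (Fin d) (Fin d) ℝ) (σ : ℝ)
    (x : Fin T → EuclideanSpace ℝ (Fin d))
    (Z₀ : Fin d → EuclideanSpace ℝ (Fin M)) (z : Fin T → EuclideanSpace ℝ (Fin M)) :
    Matrix (Fin d) (Fin M) ℝ :=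
  posteriorCov S₀ σ x *
    (S₀ ^ (-(1 / 2) : ℝ) * Matrix.of (fun i j => Z₀ i j)
      + (1 / σ) • ∑ t, vecMulVec (x t).ofLp (z t).ofLp)

/-- The quadratic form `uᵀ B u`. -/
def quadForm {d : ℕ} (B : Matrix (Fin d) (Fin d) ℝ) (u : EuclideanSpace ℝ (Fin d)) : ℝ :=
  u.ofLp ⬝ᵥ (B *ᵥ u.ofLp)

/-- `(1 - ε) uᵀ S u ≤ uᵀ A Aᵀ u ≤ (1 + ε) uᵀ S u` for all `u ∈ 𝒳`. -/
def IsApproxFactorOn {d M : ℕ} (ε : ℝ) (S : Matrix (Fin d) (Fin d) ℝ)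
    (A : Matrix (Fin d) (Fin M) ℝ) (𝒳 : Set (EuclideanSpace ℝ (Fin d))) : Prop :=
  ∀ u ∈ 𝒳, (1 - ε) * quadForm S u ≤ quadForm (A * Aᵀ) u ∧
    quadForm (A * Aᵀ) u ≤ (1 + ε) * quadForm S u

end Hypermodel

end

/-!
Both quadratic forms are squared norms: `uᵀ Σ u = ‖a‖²` and `uᵀ A Aᵀ u = ‖∑ aᵢ zᵢ‖²`, where `a`
depends linearly on `u` and the `zᵢ` are the independent spherical vectors from which `A` is built.
So the theorem says that `a ↦ ∑ aᵢ zᵢ` is nearly isometric, on a subspace of dimension at most `d`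
in (a) and on a finite set in (b).

Writing a standard Gaussian vector in polar coordinates and applying Jensen's inequality to its
radius shows that a uniform vector on the sphere of `ℝᵐ` satisfies `E exp ⟨v, z⟩ ≤ exp (‖v‖² / m)`.
Conditioning on all but one of the vectors at a time turns this into a bound for the moment
generating function of `‖∑ aᵢ zᵢ‖²`, and Markov's inequality gives concentration around `‖a‖²`
with failure probability `2 exp (- m t² / 16)`. A union bound settles finite sets. For a subspace,
apply it to a `1/4`-net of the unit sphere, which needs at most `9ᵈ` points: the self-adjoint
operator whose quadratic form is `‖∑ aᵢ zᵢ‖² - ‖a‖²` has norm at most twice its maximum on the net.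
-/

namespace Hypermodel

section RadialGaussian

theorem integrableOn_pow_mul_exp_linear_sub_sq (k : ℕ) (s : ℝ) :
    IntegrableOn (fun r : ℝ => r ^ k * Real.exp (r * s - r ^ 2 / 2)) (Set.Ioi 0) := by
  have hdom := (integrable_rpow_mul_exp_neg_mul_sq (b := 1 / 4) (by norm_num)
    (s := (k : ℝ)) (by linarith [Nat.cast_nonneg (α := ℝ) k])).const_mul (Real.exp (s ^ 2))
  refine Integrable.mono' hdom.integrableOn (by fun_prop) ?_
  refine (ae_restrict_iff' measurableSet_Ioi).2 (.of_forall fun r (hr : 0 < r) => ?_)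
  rw [Real.norm_of_nonneg (by positivity), Real.rpow_natCast, mul_left_comm, ← Real.exp_add]
  gcongr
  linarith [sq_nonneg (r - 2 * s)]

/-- The unnormalized `k`-th moment `∫₀^∞ rᵏ e^{-r²/2} dr` of the half-normal distribution. -/
noncomputable def halfNormalMoment (k : ℕ) : ℝ :=
  ∫ r in Set.Ioi (0 : ℝ), r ^ k * Real.exp (-(r ^ 2 / 2))

theorem integrableOn_halfNormalMoment (k : ℕ) :
    IntegrableOn (fun r : ℝ => r ^ k * Real.exp (-(r ^ 2 / 2))) (Set.Ioi 0) := by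
  simpa only [mul_zero, zero_sub] using integrableOn_pow_mul_exp_linear_sub_sq k 0

theorem halfNormalMoment_eq_Gamma (k : ℕ) :
    halfNormalMoment k =
      (1 / 2 : ℝ) ^ (-((k : ℝ) + 1) / 2) * (1 / 2) * Real.Gamma (((k : ℝ) + 1) / 2) := by
  rw [halfNormalMoment, ← integral_rpow_mul_exp_neg_mul_rpow (p := 2) (q := k) (b := 1 / 2)
    (by norm_num) (by linarith [Nat.cast_nonneg (α := ℝ) k]) (by norm_num)]
  refine setIntegral_congr_fun measurableSet_Ioi fun r _ => ?_
  simp only [Real.rpow_natCast, Real.rpow_ofNat]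
  ring_nf

theorem halfNormalMoment_pos (k : ℕ) : 0 < halfNormalMoment k := by
  have := Real.Gamma_pos_of_pos (s := ((k : ℝ) + 1) / 2) (by positivity)
  rw [halfNormalMoment_eq_Gamma]
  positivity

theorem halfNormalMoment_add_two (k : ℕ) :
    halfNormalMoment (k + 2) = (k + 1) * halfNormalMoment k := by
  have hexp : -((k + 2 : ℕ) + 1 : ℝ) / 2 = -((k : ℝ) + 1) / 2 - 1 := by push_cast; ring
  have harg : ((k + 2 : ℕ) + 1 : ℝ) / 2 = ((k : ℝ) + 1) / 2 + 1 := by push_cast; ring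
  rw [halfNormalMoment_eq_Gamma, halfNormalMoment_eq_Gamma, hexp, harg,
    Real.Gamma_add_one (by positivity), Real.rpow_sub_one (by norm_num)]
  ring

theorem halfNormalMoment_succ_sq_le (k : ℕ) :
    halfNormalMoment (k + 1) ^ 2 ≤ halfNormalMoment k * halfNormalMoment (k + 2) := by
  have hGamma : Real.Gamma ((k + 2) / 2) ^ 2 ≤
      Real.Gamma ((k + 1) / 2) * Real.Gamma ((k + 3) / 2) := by
    have hs := Real.Gamma_pos_of_pos (s := ((k : ℝ) + 1) / 2) (by positivity)
    have ht := Real.Gamma_pos_of_pos (s := ((k : ℝ) + 3) / 2) (by positivity)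
    have hmid := Real.Gamma_mul_add_mul_le_rpow_Gamma_mul_rpow_Gamma
      (s := (k + 1) / 2) (t := (k + 3) / 2) (a := 1 / 2) (b := 1 / 2)
      (by positivity) (by positivity) (by norm_num) (by norm_num) (by norm_num)
    rw [← Real.mul_rpow hs.le ht.le, ← Real.sqrt_eq_rpow] at hmid
    convert Real.le_sqrt' (Real.Gamma_pos_of_pos (by positivity)) |>.1 hmid using 3
    ring
  have hpow : ((1 / 2 : ℝ) ^ (-((k : ℝ) + 2) / 2)) ^ 2 =
      (1 / 2) ^ (-((k : ℝ) + 1) / 2) * (1 / 2) ^ (-((k : ℝ) + 3) / 2) := by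
    rw [sq, ← Real.rpow_add (by norm_num), ← Real.rpow_add (by norm_num)]
    ring_nf
  simp only [halfNormalMoment_eq_Gamma, Nat.cast_add, Nat.cast_one, Nat.cast_ofNat, add_assoc]
  norm_num only
  calc ((1 / 2 : ℝ) ^ (-((k : ℝ) + 2) / 2) * (1 / 2) * Real.Gamma ((k + 2) / 2)) ^ 2
      = (1 / 2) ^ (-((k : ℝ) + 1) / 2) * (1 / 2) ^ (-((k : ℝ) + 3) / 2) * (1 / 4) *
          Real.Gamma ((k + 2) / 2) ^ 2 := by rw [mul_pow, mul_pow, hpow]; ring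
    _ ≤ (1 / 2) ^ (-((k : ℝ) + 1) / 2) * (1 / 2) ^ (-((k : ℝ) + 3) / 2) * (1 / 4) *
          (Real.Gamma ((k + 1) / 2) * Real.Gamma ((k + 3) / 2)) := by gcongr
    _ = _ := by ring

/-- The mean of the chi distribution with `n` degrees of freedom, that is, the mean norm of a
standard Gaussian vector in dimension `n`; the value at `n = 0` is a junk value. -/
noncomputable def chiMean (n : ℕ) : ℝ :=
  halfNormalMoment n / halfNormalMoment (n - 1)

theorem chiMean_pos (n : ℕ) : 0 < chiMean n :=
  div_pos (halfNormalMoment_pos _) (halfNormalMoment_pos _)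

theorem half_le_chiMean_sq (n : ℕ) : (n : ℝ) / 2 ≤ chiMean n ^ 2 := by
  rcases n with - | k
  · simpa using sq_nonneg (chiMean 0)
  have hk := halfNormalMoment_pos k
  have hconvex : (k + 1) ^ 2 * halfNormalMoment k ^ 2 ≤
      (k + 2) * halfNormalMoment (k + 1) ^ 2 := by
    have h := halfNormalMoment_succ_sq_le (k + 1)
    rw [halfNormalMoment_add_two, halfNormalMoment_add_two (k + 1)] at h
    push_cast at h
    linarith
  rw [chiMean, Nat.add_sub_cancel, div_pow, le_div_iff₀ (by positivity)]
  push_cast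
  have hfactor : (k + 2 : ℝ) / 2 ≤ k + 1 := by linarith [Nat.cast_nonneg (α := ℝ) k]
  refine le_of_mul_le_mul_left ?_ (by positivity : (0 : ℝ) < k + 2)
  calc (k + 2 : ℝ) * ((k + 1) / 2 * halfNormalMoment k ^ 2)
      = (k + 2) / 2 * ((k + 1) * halfNormalMoment k ^ 2) := by ring
    _ ≤ (k + 1) * ((k + 1) * halfNormalMoment k ^ 2) := by gcongr
    _ = (k + 1) ^ 2 * halfNormalMoment k ^ 2 := by ring
    _ ≤ (k + 2) * halfNormalMoment (k + 1) ^ 2 := hconvex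

/-- Jensen's inequality, by integrating the tangent of `r ↦ exp (r * s)` at `chiMean n`. -/
theorem exp_chiMean_mul_le {n : ℕ} (hn : n ≠ 0) (s : ℝ) :
    Real.exp (chiMean n * s) * halfNormalMoment (n - 1) ≤
      ∫ r in Set.Ioi (0 : ℝ), r ^ (n - 1) * Real.exp (r * s - r ^ 2 / 2) := by
  obtain ⟨k, rfl⟩ := Nat.exists_eq_succ_of_ne_zero hn
  rw [Nat.succ_eq_add_one, Nat.add_sub_cancel]
  set m := chiMean (k + 1)
  have hm : m * halfNormalMoment k = halfNormalMoment (k + 1) :=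
    div_mul_cancel₀ _ (halfNormalMoment_pos k).ne'
  have hi := integrableOn_halfNormalMoment
  have htangent : Real.exp (m * s) * halfNormalMoment k =
      ∫ r in Set.Ioi (0 : ℝ),
        (Real.exp (m * s) * (1 - m * s) * (r ^ k * Real.exp (-(r ^ 2 / 2))) +
          Real.exp (m * s) * s * (r ^ (k + 1) * Real.exp (-(r ^ 2 / 2)))) := by
    rw [integral_add ((hi _).const_mul _) ((hi _).const_mul _), integral_const_mul,
      integral_const_mul, ← halfNormalMoment, ← halfNormalMoment, ← hm]
    ring
  rw [htangent]
  refine setIntegral_mono_on (((hi _).const_mul _).add ((hi _).const_mul _))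
    (integrableOn_pow_mul_exp_linear_sub_sq _ _) measurableSet_Ioi fun r (hr : 0 < r) => ?_
  calc Real.exp (m * s) * (1 - m * s) * (r ^ k * Real.exp (-(r ^ 2 / 2))) +
        Real.exp (m * s) * s * (r ^ (k + 1) * Real.exp (-(r ^ 2 / 2)))
      = r ^ k * Real.exp (-(r ^ 2 / 2)) * Real.exp (m * s) * ((r - m) * s + 1) := by ring
    _ ≤ r ^ k * Real.exp (-(r ^ 2 / 2)) * Real.exp (m * s) * Real.exp ((r - m) * s) := by
        gcongr
        exact Real.add_one_le_exp _
    _ = r ^ k * Real.exp (r * s - r ^ 2 / 2) := by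
        rw [mul_assoc, mul_assoc, ← Real.exp_add, ← Real.exp_add]
        ring_nf

end RadialGaussian

section Sphere

variable {E : Type*} [NormedAddCommGroup E] [MeasurableSpace E] [BorelSpace E]

theorem lintegral_eq_lintegral_toSphere [NormedSpace ℝ E] [FiniteDimensional ℝ E] [Nontrivial E]
    (μ : Measure E) [μ.IsAddHaarMeasure] {f : E → ENNReal} (hf : Measurable f) :
    ∫⁻ x, f x ∂μ = ∫⁻ z : Metric.sphere (0 : E) 1, (∫⁻ r in Set.Ioi (0 : ℝ),
      ENNReal.ofReal (r ^ (Module.finrank ℝ E - 1)) * f (r • (z : E))) ∂μ.toSphere := by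
  let g : Metric.sphere (0 : E) 1 × Set.Ioi (0 : ℝ) → ENNReal := fun p => f ((p.2 : ℝ) • (p.1 : E))
  have hpolar (x : ({0}ᶜ : Set E)) : f x = g (homeomorphUnitSphereProd E x) := by
    have hx : ‖(x : E)‖ ≠ 0 := norm_ne_zero_iff.2 x.2
    simp [g, smul_smul, hx]
  calc ∫⁻ x, f x ∂μ = ∫⁻ x : ({0}ᶜ : Set E), f x ∂(μ.comap (↑)) := by
        rw [lintegral_subtype_comap (measurableSet_singleton _).compl f, restrict_compl_singleton]
    _ = ∫⁻ p, g p ∂(μ.toSphere.prod (.volumeIoiPow (Module.finrank ℝ E - 1))) := by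
        simp_rw [hpolar]
        exact μ.measurePreserving_homeomorphUnitSphereProd.lintegral_comp_emb
          (Homeomorph.measurableEmbedding _) g
    _ = _ := by
        rw [lintegral_prod _ (by fun_prop)]
        refine lintegral_congr fun z => ?_
        rw [Measure.volumeIoiPow,
          lintegral_withDensity_eq_lintegral_mul _ (by fun_prop) (by fun_prop),
          ← lintegral_subtype_comap measurableSet_Ioi]
        rfl

variable [InnerProductSpace ℝ E]

/-- Complete the square and translate. -/
theorem lintegral_exp_inner_sub_norm_sq (μ : Measure E) [μ.IsAddRightInvariant] (v : E) :
    ∫⁻ x, ENNReal.ofReal (Real.exp (inner ℝ v x - ‖x‖ ^ 2 / 2)) ∂μ =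
      ENNReal.ofReal (Real.exp (‖v‖ ^ 2 / 2)) *
        ∫⁻ x, ENNReal.ofReal (Real.exp (-(‖x‖ ^ 2 / 2))) ∂μ := by
  rw [← lintegral_sub_right_eq_self (fun x => ENNReal.ofReal (Real.exp (-(‖x‖ ^ 2 / 2)))) v,
    ← lintegral_const_mul' _ _ ENNReal.ofReal_ne_top]
  refine lintegral_congr fun x => ?_
  rw [← ENNReal.ofReal_mul (Real.exp_pos _).le, ← Real.exp_add, norm_sub_sq_real,
    real_inner_comm]
  ring_nf

variable [FiniteDimensional ℝ E]

theorem lintegral_exp_inner_sub_norm_sq_eq_lintegral_toSphere [Nontrivial E] (μ : Measure E)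
    [μ.IsAddHaarMeasure] (v : E) :
    ∫⁻ x, ENNReal.ofReal (Real.exp (inner ℝ v x - ‖x‖ ^ 2 / 2)) ∂μ =
      ∫⁻ z : Metric.sphere (0 : E) 1, ENNReal.ofReal (∫ r in Set.Ioi (0 : ℝ),
        r ^ (Module.finrank ℝ E - 1) * Real.exp (r * inner ℝ v (z : E) - r ^ 2 / 2))
        ∂μ.toSphere := by
  rw [lintegral_eq_lintegral_toSphere _ (by fun_prop)]
  refine lintegral_congr fun z => ?_
  rw [ofReal_integral_eq_lintegral_ofReal (integrableOn_pow_mul_exp_linear_sub_sq _ _)]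
  · refine setLIntegral_congr_fun measurableSet_Ioi fun r (hr : 0 < r) => ?_
    rw [← ENNReal.ofReal_mul (by positivity), inner_smul_right, norm_smul,
      norm_eq_of_mem_sphere, Real.norm_of_nonneg hr.le, mul_one]
  · refine (ae_restrict_iff' measurableSet_Ioi).2 (.of_forall fun r (hr : 0 < r) => ?_)
    simp only [Pi.zero_apply]
    positivity

theorem lintegral_exp_chiMean_mul_inner_toSphere_le (μ : Measure E) [μ.IsAddHaarMeasure] (v : E) :
    ∫⁻ z : Metric.sphere (0 : E) 1,
        ENNReal.ofReal (Real.exp (chiMean (Module.finrank ℝ E) * inner ℝ v (z : E))) ∂μ.toSphere ≤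
      ENNReal.ofReal (Real.exp (‖v‖ ^ 2 / 2)) * μ.toSphere Set.univ := by
  rcases subsingleton_or_nontrivial E with _ | _
  · simp [Measure.toSphere_eq_zero_iff μ |>.2 ‹_›]
  set n := Module.finrank ℝ E
  have hn : n ≠ 0 := Module.finrank_pos.ne'
  have hI := halfNormalMoment_pos (n - 1)
  have hgauss : ∫⁻ x, ENNReal.ofReal (Real.exp (-(‖x‖ ^ 2 / 2))) ∂μ =
      ENNReal.ofReal (halfNormalMoment (n - 1)) * μ.toSphere Set.univ := by
    simpa [halfNormalMoment] using lintegral_exp_inner_sub_norm_sq_eq_lintegral_toSphere μ (0 : E)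
  refine (ENNReal.mul_le_mul_iff_right (ENNReal.ofReal_pos.2 hI).ne' ENNReal.ofReal_ne_top).1 ?_
  calc ENNReal.ofReal (halfNormalMoment (n - 1)) * ∫⁻ z : Metric.sphere (0 : E) 1,
        ENNReal.ofReal (Real.exp (chiMean n * inner ℝ v (z : E))) ∂μ.toSphere
      = ∫⁻ z : Metric.sphere (0 : E) 1, ENNReal.ofReal
          (Real.exp (chiMean n * inner ℝ v (z : E)) * halfNormalMoment (n - 1)) ∂μ.toSphere := by
        simp_rw [ENNReal.ofReal_mul' hI.le]
        rw [lintegral_mul_const' _ _ ENNReal.ofReal_ne_top, mul_comm]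
    _ ≤ ∫⁻ x, ENNReal.ofReal (Real.exp (inner ℝ v x - ‖x‖ ^ 2 / 2)) ∂μ := by
        rw [lintegral_exp_inner_sub_norm_sq_eq_lintegral_toSphere]
        exact lintegral_mono fun z => ENNReal.ofReal_le_ofReal (exp_chiMean_mul_le hn _)
    _ = ENNReal.ofReal (halfNormalMoment (n - 1)) *
          (ENNReal.ofReal (Real.exp (‖v‖ ^ 2 / 2)) * μ.toSphere Set.univ) := by
        rw [lintegral_exp_inner_sub_norm_sq, hgauss, mul_left_comm]

theorem lintegral_exp_inner_toSphere_le (μ : Measure E) [μ.IsAddHaarMeasure] (v : E) :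
    ∫⁻ z : Metric.sphere (0 : E) 1, ENNReal.ofReal (Real.exp (inner ℝ v (z : E))) ∂μ.toSphere ≤
      ENNReal.ofReal (Real.exp (‖v‖ ^ 2 / Module.finrank ℝ E)) * μ.toSphere Set.univ := by
  rcases subsingleton_or_nontrivial E with _ | _
  · simp [Measure.toSphere_eq_zero_iff μ |>.2 ‹_›]
  set n := Module.finrank ℝ E
  have hn : (0 : ℝ) < n := Nat.cast_pos.2 Module.finrank_pos
  have hchi := chiMean_pos n
  have hscaled := lintegral_exp_chiMean_mul_inner_toSphere_le μ ((chiMean n)⁻¹ • v)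
  have hnorm : ‖(chiMean n)⁻¹ • v‖ ^ 2 / 2 ≤ ‖v‖ ^ 2 / n := by
    rw [norm_smul, mul_pow, norm_inv, inv_pow, Real.norm_eq_abs, sq_abs,
      div_le_div_iff₀ two_pos hn, mul_right_comm, mul_comm (‖v‖ ^ 2)]
    gcongr
    rw [inv_mul_le_iff₀ (by positivity)]
    linarith [half_le_chiMean_sq n]
  simp only [inner_smul_left, map_inv₀, conj_trivial, n, mul_inv_cancel_left₀ hchi.ne']
    at hscaled
  refine hscaled.trans (mul_le_mul_left ?_ _)
  exact ENNReal.ofReal_le_ofReal (Real.exp_le_exp.2 hnorm)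

theorem lintegral_exp_inner_uniformSphere_le {m : ℕ} (v : EuclideanSpace ℝ (Fin m)) :
    ∫⁻ z, ENNReal.ofReal (Real.exp (inner ℝ v z)) ∂uniformSphere m ≤
      ENNReal.ofReal (Real.exp (‖v‖ ^ 2 / m)) := by
  have htoSphere := lintegral_exp_inner_toSphere_le volume v
  rw [finrank_euclideanSpace_fin] at htoSphere
  rw [uniformSphere, lintegral_map (by fun_prop) (by fun_prop), ProbabilityTheory.cond,
    Measure.restrict_univ, lintegral_smul_measure, smul_eq_mul, mul_comm, ← div_eq_mul_inv]
  exact ENNReal.div_le_of_le_mul htoSphere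

theorem ae_norm_eq_one_uniformSphere (m : ℕ) : ∀ᵐ z ∂uniformSphere m, ‖z‖ = 1 := by
  rw [uniformSphere, ae_map_iff (by fun_prop) (measurableSet_eq_fun (by fun_prop) (by fun_prop))]
  exact .of_forall norm_eq_of_mem_sphere

end Sphere

section Concentration

theorem lintegral_exp_norm_add_smul_sq_le {m : ℕ} (μ a : ℝ) (s : EuclideanSpace ℝ (Fin m)) :
    ∫⁻ z, ENNReal.ofReal (Real.exp (m / 2 * (μ * ‖s + a • z‖ ^ 2))) ∂uniformSphere m ≤
      ENNReal.ofReal (Real.exp (m / 2 * (μ * a ^ 2))) *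
        ENNReal.ofReal (Real.exp (m / 2 * ((μ + 2 * μ ^ 2 * a ^ 2) * ‖s‖ ^ 2))) := by
  have hexpand : ∀ᵐ z ∂uniformSphere m,
      ENNReal.ofReal (Real.exp (m / 2 * (μ * ‖s + a • z‖ ^ 2))) =
        ENNReal.ofReal (Real.exp (m / 2 * (μ * (‖s‖ ^ 2 + a ^ 2)))) *
          ENNReal.ofReal (Real.exp (inner ℝ ((m * μ * a) • s) z)) := by
    filter_upwards [ae_norm_eq_one_uniformSphere m] with z hz
    rw [← ENNReal.ofReal_mul (Real.exp_pos _).le, ← Real.exp_add, norm_add_sq_real,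
      real_inner_smul_left, real_inner_smul_right, norm_smul, hz, mul_one, Real.norm_eq_abs, sq_abs]
    ring_nf
  have hvariance : ‖(m * μ * a) • s‖ ^ 2 / m = m * (μ ^ 2 * a ^ 2 * ‖s‖ ^ 2) := by
    rw [norm_smul, mul_pow, Real.norm_eq_abs, sq_abs]
    linear_combination (μ ^ 2 * a ^ 2 * ‖s‖ ^ 2) * mul_self_div_self (m : ℝ)
  rw [lintegral_congr_ae hexpand, lintegral_const_mul _ (by fun_prop)]
  refine (mul_le_mul_right (lintegral_exp_inner_uniformSphere_le _) _).trans_eq ?_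
  rw [hvariance, ← ENNReal.ofReal_mul (Real.exp_pos _).le, ← Real.exp_add,
    ← ENNReal.ofReal_mul (Real.exp_pos _).le, ← Real.exp_add]
  ring_nf

variable {Ω ι : Type*} [MeasurableSpace Ω] {P : Measure Ω} {m : ℕ}

theorem lintegral_exp_norm_add_smul_sq_le_of_indepFun [IsProbabilityMeasure P]
    {X Z : Ω → EuclideanSpace ℝ (Fin m)} (hX : AEMeasurable X P)
    (hZ : HasLaw Z (uniformSphere m) P) (hXZ : IndepFun X Z P) (μ a : ℝ) :
    ∫⁻ ω, ENNReal.ofReal (Real.exp (m / 2 * (μ * ‖X ω + a • Z ω‖ ^ 2))) ∂P ≤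
      ENNReal.ofReal (Real.exp (m / 2 * (μ * a ^ 2))) *
        ∫⁻ ω, ENNReal.ofReal (Real.exp (m / 2 * ((μ + 2 * μ ^ 2 * a ^ 2) * ‖X ω‖ ^ 2))) ∂P := by
  have := hZ.isProbabilityMeasure_iff.1 ‹_›
  have := Measure.isProbabilityMeasure_map hX
  have hprod := (indepFun_iff_map_prod_eq_prod_map_map hX hZ.aemeasurable).1 hXZ
  rw [hZ.map_eq] at hprod
  calc ∫⁻ ω, ENNReal.ofReal (Real.exp (m / 2 * (μ * ‖X ω + a • Z ω‖ ^ 2))) ∂P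
      = ∫⁻ v, ∫⁻ z, ENNReal.ofReal (Real.exp (m / 2 * (μ * ‖v + a • z‖ ^ 2)))
          ∂uniformSphere m ∂(P.map X) := by
        rw [← lintegral_prod
            (fun p => ENNReal.ofReal (Real.exp (m / 2 * (μ * ‖p.1 + a • p.2‖ ^ 2)))) (by fun_prop),
          ← hprod, lintegral_map' (by fun_prop) (hX.prodMk hZ.aemeasurable)]
    _ ≤ ∫⁻ v, ENNReal.ofReal (Real.exp (m / 2 * (μ * a ^ 2))) *
          ENNReal.ofReal (Real.exp (m / 2 * ((μ + 2 * μ ^ 2 * a ^ 2) * ‖v‖ ^ 2))) ∂(P.map X) :=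
        lintegral_mono fun v => lintegral_exp_norm_add_smul_sq_le _ _ _
    _ = _ := by rw [lintegral_const_mul _ (by fun_prop), lintegral_map' (by fun_prop) hX]

theorem indepFun_finsetSum_smul_of_notMem {R E : Type*} [Semiring R] [AddCommMonoid E] [Module R E]
    [MeasurableSpace E] [MeasurableAdd₂ E] [MeasurableConstSMul R E] {X : ι → Ω → E}
    (hX : iIndepFun X P) (hX_meas : ∀ i, AEMeasurable (X i) P) (a : ι → R) {F : Finset ι} {k : ι}
    (hk : k ∉ F) : IndepFun (fun ω => ∑ i ∈ F, a i • X i ω) (X k) P := by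
  classical
  have hind := (hX.comp (fun i v => Function.update a k 1 i • v)
    fun i => measurable_const_smul _).indepFun_finsetSum_of_notMem₀
      (fun i => (hX_meas i).const_smul (Function.update a k 1 i)) hk
  convert hind using 1
  · ext1 ω
    rw [Finset.sum_apply]
    refine Finset.sum_congr rfl fun i hi => ?_
    simp [Function.update_of_ne (ne_of_mem_of_not_mem hi hk)]
  · ext1 ω
    simp

theorem abs_add_two_mul_sq_mul_mul_le {μ s b : ℝ} (hs : 0 ≤ s) (hb : 0 ≤ b)
    (hμ : |μ| * s ≤ 1 / 2) : |μ + 2 * μ ^ 2 * b| * s ≤ |μ| * (b + s) := by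
  calc |μ + 2 * μ ^ 2 * b| * s ≤ (|μ| + |2 * μ ^ 2 * b|) * s := by gcongr; exact abs_add_le _ _
    _ = |μ| * s + 2 * (|μ| * b) * (|μ| * s) := by
        rw [abs_of_nonneg (a := 2 * μ ^ 2 * b) (by positivity), ← sq_abs μ]
        ring
    _ ≤ |μ| * s + 2 * (|μ| * b) * (1 / 2) := by gcongr
    _ = |μ| * (b + s) := by ring

theorem mul_add_add_mul_add_sq_le {μ s b : ℝ} (hs : 0 ≤ s) (hb : 0 ≤ b) (hμ : |μ| * s ≤ 1 / 4) :
    μ * b + ((μ + 2 * μ ^ 2 * b) * s + 2 * (μ + 2 * μ ^ 2 * b) ^ 2 * s ^ 2) ≤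
      μ * (b + s) + 2 * μ ^ 2 * (b + s) ^ 2 := by
  have hlin : μ * s ≤ 1 / 4 := (mul_le_mul_of_nonneg_right (le_abs_self μ) hs).trans hμ
  have hsq : (μ * s) ^ 2 ≤ (1 / 4) ^ 2 :=
    sq_le_sq' (by linarith [mul_le_mul_of_nonneg_right (neg_abs_le μ) hs]) hlin
  have hgap : 0 ≤ 2 * μ ^ 2 * b * (s * (1 - 4 * (μ * s)) + b * (1 - 4 * (μ * s) ^ 2)) := by
    have : 0 ≤ 1 - 4 * (μ * s) := by linarith
    have : 0 ≤ 1 - 4 * (μ * s) ^ 2 := by linarith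
    positivity
  linarith

variable {z : ι → Ω → EuclideanSpace ℝ (Fin m)}

theorem IsSpherical.lintegral_exp_norm_sum_sq_le [IsProbabilityMeasure P] (hz : IsSpherical P z)
    (a : ι → ℝ) (F : Finset ι) {μ : ℝ} (hμ : |μ| * ∑ i ∈ F, a i ^ 2 ≤ 1 / 4) :
    ∫⁻ ω, ENNReal.ofReal (Real.exp (m / 2 * (μ * ‖∑ i ∈ F, a i • z i ω‖ ^ 2))) ∂P ≤
      ENNReal.ofReal (Real.exp (m / 2 *
        (μ * ∑ i ∈ F, a i ^ 2 + 2 * μ ^ 2 * (∑ i ∈ F, a i ^ 2) ^ 2))) := by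
  classical
  have hz_meas : ∀ i, AEMeasurable (z i) P := fun i => (hz.hasLaw i).aemeasurable
  induction F using Finset.induction_on generalizing μ with
  | empty => simp
  | insert k F hk ih =>
    rw [Finset.sum_insert hk] at hμ ⊢
    set s := ∑ i ∈ F, a i ^ 2
    set b := a k ^ 2
    have hs : 0 ≤ s := Finset.sum_nonneg fun i _ => sq_nonneg _
    have hb : 0 ≤ b := sq_nonneg _
    have hμs : |μ| * s ≤ 1 / 4 := (by gcongr; linarith : |μ| * s ≤ |μ| * (b + s)).trans hμ
    calc ∫⁻ ω, ENNReal.ofReal (Real.exp (m / 2 * (μ * ‖∑ i ∈ insert k F, a i • z i ω‖ ^ 2))) ∂P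
        ≤ ENNReal.ofReal (Real.exp (m / 2 * (μ * b))) * ∫⁻ ω, ENNReal.ofReal
            (Real.exp (m / 2 * ((μ + 2 * μ ^ 2 * b) * ‖∑ i ∈ F, a i • z i ω‖ ^ 2))) ∂P := by
          simp_rw [Finset.sum_insert hk, add_comm (a k • _)]
          exact lintegral_exp_norm_add_smul_sq_le_of_indepFun
            (Finset.aemeasurable_fun_sum _ fun i _ => (hz_meas i).const_smul (a i)) (hz.hasLaw k)
            (indepFun_finsetSum_smul_of_notMem hz.indep hz_meas a hk) μ (a k)
      _ ≤ ENNReal.ofReal (Real.exp (m / 2 * (μ * b))) * ENNReal.ofReal (Real.exp (m / 2 *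
            ((μ + 2 * μ ^ 2 * b) * s + 2 * (μ + 2 * μ ^ 2 * b) ^ 2 * s ^ 2))) := by
          gcongr
          exact ih ((abs_add_two_mul_sq_mul_mul_le hs hb (by linarith)).trans hμ)
      _ ≤ ENNReal.ofReal (Real.exp (m / 2 * (μ * (b + s) + 2 * μ ^ 2 * (b + s) ^ 2))) := by
          rw [← ENNReal.ofReal_mul (Real.exp_pos _).le, ← Real.exp_add, ← mul_add]
          gcongr ENNReal.ofReal (Real.exp (m / 2 * ?_))
          exact mul_add_add_mul_add_sq_le hs hb hμs

theorem measure_ge_le_of_lintegral_exp_le {Y : Ω → ℝ} (hY : AEMeasurable Y P) {b : ℝ}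
    (h : ∫⁻ ω, ENNReal.ofReal (Real.exp (Y ω)) ∂P ≤ ENNReal.ofReal (Real.exp b)) (c : ℝ) :
    P {ω | c ≤ Y ω} ≤ ENNReal.ofReal (Real.exp (b - c)) := by
  have hexp : {ω | c ≤ Y ω} =
      {ω | ENNReal.ofReal (Real.exp c) ≤ ENNReal.ofReal (Real.exp (Y ω))} := by
    simp only [ENNReal.ofReal_le_ofReal_iff (Real.exp_pos _).le, Real.exp_le_exp]
  rw [Real.exp_sub, ENNReal.ofReal_div_of_pos (Real.exp_pos c), hexp]
  exact (meas_ge_le_lintegral_div (by fun_prop) (ENNReal.ofReal_pos.2 (Real.exp_pos c)).ne'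
    ENNReal.ofReal_ne_top).trans (ENNReal.div_le_div_right h _)

variable [Fintype ι]

/-- The synthesis operator `a ↦ ∑ i, a i • z i` of a finite family of vectors. -/
noncomputable def synthesis {F : Type*} [NormedAddCommGroup F] [NormedSpace ℝ F] (z : ι → F) :
    EuclideanSpace ℝ ι →L[ℝ] F :=
  ∑ i, (EuclideanSpace.proj i).smulRight (z i)

theorem synthesis_apply {F : Type*} [NormedAddCommGroup F] [NormedSpace ℝ F] (z : ι → F)
    (a : EuclideanSpace ℝ ι) : synthesis z a = ∑ i, a i • z i := by
  simp [synthesis]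

theorem IsSpherical.aemeasurable_synthesis (hz : IsSpherical P z) (a : EuclideanSpace ℝ ι) :
    AEMeasurable (fun ω => synthesis (z · ω) a) P := by
  simp only [synthesis_apply]
  exact Finset.aemeasurable_fun_sum _ fun i _ => (hz.hasLaw i).aemeasurable.const_smul (a i)

theorem IsSpherical.measure_mul_norm_sq_add_le [IsProbabilityMeasure P] (hz : IsSpherical P z)
    (a : EuclideanSpace ℝ ι) {μ : ℝ} (hμ : |μ| * ‖a‖ ^ 2 ≤ 1 / 4) :
    P {ω | μ * ‖a‖ ^ 2 + 4 * (μ * ‖a‖ ^ 2) ^ 2 ≤ μ * ‖synthesis (z · ω) a‖ ^ 2} ≤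
      ENNReal.ofReal (Real.exp (-(m * (μ * ‖a‖ ^ 2) ^ 2))) := by
  have hmgf : ∫⁻ ω, ENNReal.ofReal (Real.exp (m / 2 * (μ * ‖synthesis (z · ω) a‖ ^ 2))) ∂P ≤
      ENNReal.ofReal (Real.exp (m / 2 * (μ * ‖a‖ ^ 2 + 2 * (μ * ‖a‖ ^ 2) ^ 2))) := by
    rw [EuclideanSpace.real_norm_sq_eq] at hμ ⊢
    simp only [synthesis_apply, mul_pow, ← mul_assoc (2 : ℝ)]
    exact hz.lintegral_exp_norm_sum_sq_le a _ hμ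
  have hmeas := hz.aemeasurable_synthesis a
  have hmarkov := measure_ge_le_of_lintegral_exp_le (by fun_prop) hmgf
    (m / 2 * (μ * ‖a‖ ^ 2 + 4 * (μ * ‖a‖ ^ 2) ^ 2))
  refine (measure_mono fun ω hω => ?_).trans (hmarkov.trans_eq (by ring_nf))
  exact mul_le_mul_of_nonneg_left hω (by positivity : (0 : ℝ) ≤ m / 2)

/-- Markov's inequality applied to `exp (m * μ * ‖synthesis z a‖ ^ 2 / 2)` with
`μ = ± t / (4 * ‖a‖ ^ 2)`, one sign for each tail. -/
theorem IsSpherical.measure_lt_abs_norm_synthesis_sq_sub_le [IsProbabilityMeasure P]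
    (hz : IsSpherical P z) (a : EuclideanSpace ℝ ι) {t : ℝ} (ht : 0 ≤ t) (ht1 : t ≤ 1) :
    P {ω | t * ‖a‖ ^ 2 < |‖synthesis (z · ω) a‖ ^ 2 - ‖a‖ ^ 2|} ≤
      ENNReal.ofReal (2 * Real.exp (-(m * t ^ 2 / 16))) := by
  rcases eq_or_ne a 0 with rfl | ha
  · simp
  have ha : 0 < ‖a‖ ^ 2 := by positivity
  set s := ‖a‖ ^ 2
  set μ := t / (4 * s)
  have hμ : 0 ≤ μ := by positivity
  have hμs : μ * s = t / 4 := by simp only [μ]; field_simp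
  have hμt : μ * (t * s) = t ^ 2 / 4 := by linear_combination t * hμs
  have hupper := hz.measure_mul_norm_sq_add_le a (μ := μ)
    (by rw [abs_of_nonneg hμ]; change μ * s ≤ _; linarith)
  have hlower := hz.measure_mul_norm_sq_add_le a (μ := -μ)
    (by rw [abs_neg, abs_of_nonneg hμ]; change μ * s ≤ _; linarith)
  have hsub : {ω | t * s < |‖synthesis (z · ω) a‖ ^ 2 - s|} ⊆
      {ω | μ * s + 4 * (μ * s) ^ 2 ≤ μ * ‖synthesis (z · ω) a‖ ^ 2} ∪
        {ω | -μ * s + 4 * (-μ * s) ^ 2 ≤ -μ * ‖synthesis (z · ω) a‖ ^ 2} := by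
    intro ω hω
    rcases lt_abs.1 (Set.mem_ofPred_eq ▸ hω) with h | h
    · left
      have := mul_le_mul_of_nonneg_left h.le hμ
      simp only [Set.mem_ofPred_eq, hμs]
      linarith
    · right
      have := mul_le_mul_of_nonneg_left h.le hμ
      simp only [Set.mem_ofPred_eq, neg_mul, hμs]
      linarith
  refine (measure_mono hsub).trans ((measure_union_le _ _).trans ?_)
  rw [two_mul, ENNReal.ofReal_add (Real.exp_pos _).le (Real.exp_pos _).le]
  refine add_le_add (hupper.trans_eq ?_) (hlower.trans_eq ?_)
  · rw [hμs]; ring_nf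
  · rw [neg_mul, hμs]; ring_nf

end Concentration

section UnionBound

/-- `f` preserves squared norms up to a relative error `ε` at every point of `s`. -/
def IsNearIsometryOn {V F : Type*} [Norm V] [Norm F] (ε : ℝ) (f : V → F) (s : Set V) : Prop :=
  ∀ v ∈ s, |‖f v‖ ^ 2 - ‖v‖ ^ 2| ≤ ε * ‖v‖ ^ 2

variable {Ω ι : Type*} [MeasurableSpace Ω] {P : Measure Ω} [IsProbabilityMeasure P] {m : ℕ}
  {z : ι → Ω → EuclideanSpace ℝ (Fin m)} [Fintype ι]

theorem ofReal_one_sub_le_measure_of_compl {s : Set Ω} {δ : ℝ} (hδ : 0 ≤ δ)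
    (hs : P sᶜ ≤ ENNReal.ofReal δ) : ENNReal.ofReal (1 - δ) ≤ P s := by
  rw [ENNReal.ofReal_sub _ hδ, ENNReal.ofReal_one, tsub_le_iff_right]
  calc (1 : ENNReal) = P (s ∪ sᶜ) := by rw [Set.union_compl_self, measure_univ]
    _ ≤ P s + P sᶜ := measure_union_le _ _
    _ ≤ P s + ENNReal.ofReal δ := by gcongr

theorem mul_two_mul_exp_neg_le {c δ y : ℝ} (hc : 0 ≤ c) (hδ : 0 < δ)
    (h : Real.log (2 * c / δ) ≤ y) : c * (2 * Real.exp (-y)) ≤ δ := by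
  rcases hc.eq_or_lt with rfl | hc
  · simpa using hδ.le
  rw [Real.log_le_iff_le_exp (by positivity), div_le_iff₀ hδ] at h
  rw [Real.exp_neg, ← mul_assoc, ← div_eq_mul_inv, div_le_iff₀ (Real.exp_pos _)]
  linarith

theorem IsSpherical.measure_compl_isNearIsometryOn_le (hz : IsSpherical P z)
    (X : Finset (EuclideanSpace ℝ ι)) {t : ℝ} (ht : 0 ≤ t) (ht1 : t ≤ 1) :
    P {ω | IsNearIsometryOn t (synthesis (z · ω)) (X : Set (EuclideanSpace ℝ ι))}ᶜ ≤
      ENNReal.ofReal (X.card * (2 * Real.exp (-(m * t ^ 2 / 16)))) := by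
  have hbad : {ω | IsNearIsometryOn t (synthesis (z · ω)) (X : Set (EuclideanSpace ℝ ι))}ᶜ =
      ⋃ a ∈ X, {ω | t * ‖a‖ ^ 2 < |‖synthesis (z · ω) a‖ ^ 2 - ‖a‖ ^ 2|} := by
    ext ω
    simp [IsNearIsometryOn]
  rw [hbad, ENNReal.ofReal_mul (Nat.cast_nonneg _), ENNReal.ofReal_natCast, ← nsmul_eq_mul]
  exact (measure_biUnion_finset_le _ _).trans (Finset.sum_le_card_nsmul _ _ _ fun a _ =>
    hz.measure_lt_abs_norm_synthesis_sq_sub_le a ht ht1)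

theorem IsSpherical.ofReal_one_sub_le_measure_isNearIsometryOn_finset (hz : IsSpherical P z)
    {X : Finset (EuclideanSpace ℝ ι)} {c : ℝ} (hX : X.card ≤ c) {t δ : ℝ} (ht : 0 < t)
    (ht1 : t ≤ 1) (hδ : 0 < δ) (hm : 16 * (t ^ 2)⁻¹ * Real.log (2 * c / δ) ≤ m) :
    ENNReal.ofReal (1 - δ) ≤
      P {ω | IsNearIsometryOn t (synthesis (z · ω)) (X : Set (EuclideanSpace ℝ ι))} := by
  have hlog : Real.log (2 * c / δ) ≤ m * t ^ 2 / 16 := by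
    rw [mul_right_comm, ← div_eq_mul_inv, div_le_iff₀ (by positivity)] at hm
    linarith
  refine ofReal_one_sub_le_measure_of_compl hδ.le
    ((hz.measure_compl_isNearIsometryOn_le X ht.le ht1).trans (ENNReal.ofReal_le_ofReal ?_))
  calc X.card * (2 * Real.exp (-(m * t ^ 2 / 16)))
      ≤ c * (2 * Real.exp (-(m * t ^ 2 / 16))) := by gcongr
    _ ≤ δ := mul_two_mul_exp_neg_le ((Nat.cast_nonneg _).trans hX) hδ hlog

end UnionBound

section Net

open Metric NNReal

variable {E : Type*} [NormedAddCommGroup E] [NormedSpace ℝ E] [FiniteDimensional ℝ E]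

/-- The balls of radius `ε / 2` about the points of `C` are disjoint and contained in the ball of
radius `1 + ε / 2`; compare volumes. -/
theorem card_le_of_isSeparated {ε : ℝ≥0} (hε : 0 < ε) {C : Finset E}
    (hC : (C : Set E) ⊆ closedBall 0 1) (hsep : IsSeparated ε (C : Set E)) :
    (C.card : ℝ) ≤ (1 + 2 / ε) ^ Module.finrank ℝ E := by
  borelize E
  let μ : Measure E := Measure.addHaar
  set n := Module.finrank ℝ E
  have hdisj : (C : Set E).PairwiseDisjoint fun c => ball c (ε / 2 : ℝ) := by
    intro c hc c' hc' hne
    apply ball_disjoint_ball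
    have hdist : (ε : ENNReal) < edist c c' := hsep hc hc' hne
    rw [edist_nndist, ENNReal.coe_lt_coe] at hdist
    rw [add_halves]
    exact hdist.le
  have hsub : ⋃ c ∈ C, ball c (ε / 2 : ℝ) ⊆ ball (0 : E) (1 + ε / 2) :=
    Set.iUnion₂_subset fun c hc => ball_subset_ball' (by linarith [mem_closedBall.1 (hC hc)])
  have hvolume : (C.card : ENNReal) * ENNReal.ofReal ((ε / 2) ^ n) * μ (ball 0 1) ≤
      ENNReal.ofReal ((1 + ε / 2) ^ n) * μ (ball 0 1) := by
    calc (C.card : ENNReal) * ENNReal.ofReal ((ε / 2) ^ n) * μ (ball 0 1)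
        = μ (⋃ c ∈ C, ball c (ε / 2 : ℝ)) := by
          rw [measure_biUnion_finset hdisj fun c _ => measurableSet_ball]
          simp only [μ.addHaar_ball_of_pos _ (by positivity : (0 : ℝ) < ε / 2),
            Finset.sum_const, nsmul_eq_mul, mul_assoc, n]
      _ ≤ μ (ball (0 : E) (1 + ε / 2)) := measure_mono hsub
      _ = _ := μ.addHaar_ball_of_pos _ (by positivity)
  rw [ENNReal.mul_le_mul_iff_left (measure_ball_pos _ _ zero_lt_one).ne' measure_ball_lt_top.ne,
    ← ENNReal.ofReal_natCast, ← ENNReal.ofReal_mul (by positivity),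
    ENNReal.ofReal_le_ofReal_iff (by positivity), ← le_div_iff₀ (by positivity),
    ← div_pow] at hvolume
  have hratio : (1 + ε / 2) / (ε / 2) = (1 + 2 / ε : ℝ) := by
    field_simp
    ring
  rwa [hratio] at hvolume

theorem packingNumber_le_floor {ε : ℝ≥0} (hε : 0 < ε) {A : Set E} (hA : A ⊆ closedBall 0 1) :
    packingNumber ε A ≤ ⌊(1 + 2 / ε : ℝ) ^ Module.finrank ℝ E⌋₊ := by
  refine iSup₂_le fun C hC => iSup_le fun hsep => ?_
  by_contra! hlt
  obtain ⟨D, hDC, hD⟩ := Set.exists_subset_encard_eq (Order.add_one_le_of_lt hlt)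
  have hfin : D.Finite := Set.finite_of_encard_eq_coe (k := _ + 1) hD
  lift D to Finset E using hfin
  have hcard := card_le_of_isSeparated hε ((hDC.trans hC).trans hA) (hsep.mono hDC)
  rw [Set.encard_coe_eq_coe_finsetCard] at hD
  have hle := Nat.le_floor hcard
  generalize ⌊(1 + 2 / ε : ℝ) ^ Module.finrank ℝ E⌋₊ = k at hD hle
  norm_cast at hD
  omega

theorem exists_isCover_card_le {ε : ℝ≥0} (hε : 0 < ε) {A : Set E} (hA : A ⊆ closedBall 0 1) :
    ∃ N : Finset E, (N : Set E) ⊆ A ∧ IsCover ε A (N : Set E) ∧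
      (N.card : ℝ) ≤ (1 + 2 / ε) ^ Module.finrank ℝ E := by
  have hle := (coveringNumber_le_packingNumber ε A).trans (packingNumber_le_floor hε hA)
  obtain ⟨N, hNA, hfin, hcover, hcard⟩ :=
    exists_set_encard_eq_coveringNumber (hle.trans_lt (ENat.natCast_lt_top _)).ne
  lift N to Finset E using hfin
  refine ⟨N, hNA, hcover, (Nat.le_floor_iff (by positivity)).1 ?_⟩
  rw [← hcard, Set.encard_coe_eq_coe_finsetCard] at hle
  exact_mod_cast hle

end Net

section NearIsometry

open Metric NNReal

variable {V F : Type*} [NormedAddCommGroup V] [InnerProductSpace ℝ V]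
  [NormedAddCommGroup F] [InnerProductSpace ℝ F]

/-- The standard net argument: if `y` is a net point near `x` then
`|⟨T x, x⟩ - ⟨T y, y⟩| ≤ 2 * δ * ‖T‖`. -/
theorem norm_le_of_isCover {T : V →L[ℝ] V} (hT : T.IsSymmetric) {δ : ℝ≥0} {N : Set V}
    (hN : N ⊆ sphere 0 1) (hcover : IsCover δ (sphere 0 1) N) {ε : ℝ} (hε : 0 ≤ ε)
    (h : ∀ y ∈ N, |inner ℝ (T y) y| ≤ ε) : ‖T‖ ≤ ε + 2 * δ * ‖T‖ := by
  have hsphere : ∀ x ∈ sphere (0 : V) 1, |inner ℝ (T x) x| ≤ ε + 2 * δ * ‖T‖ := by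
    intro x hx
    obtain ⟨y, hyN, hxy⟩ := Set.mem_iUnion₂.1 (isCover_iff_subset_iUnion_closedBall.1 hcover hx)
    rw [mem_closedBall, dist_eq_norm] at hxy
    have hx1 : ‖x‖ = 1 := by simpa using hx
    have hy1 : ‖y‖ = 1 := by simpa using hN hyN
    have hsplit : inner ℝ (T x) x = inner ℝ (T y) y + inner ℝ (T (x - y)) x
        + inner ℝ (T y) (x - y) := by
      simp only [map_sub, inner_sub_left, inner_sub_right]
      ring
    have hleft : |inner ℝ (T (x - y)) x| ≤ δ * ‖T‖ := by
      calc |inner ℝ (T (x - y)) x| ≤ ‖T (x - y)‖ * ‖x‖ := abs_real_inner_le_norm _ _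
        _ ≤ ‖T‖ * ‖x - y‖ * ‖x‖ := by gcongr; exact T.le_opNorm _
        _ ≤ δ * ‖T‖ := by rw [hx1, mul_one, mul_comm]; gcongr
    have hright : |inner ℝ (T y) (x - y)| ≤ δ * ‖T‖ := by
      calc |inner ℝ (T y) (x - y)| ≤ ‖T y‖ * ‖x - y‖ := abs_real_inner_le_norm _ _
        _ ≤ ‖T‖ * ‖y‖ * ‖x - y‖ := by gcongr; exact T.le_opNorm _
        _ ≤ δ * ‖T‖ := by rw [hy1, mul_one, mul_comm]; gcongr
    rw [hsplit]
    linarith [abs_add_three (inner ℝ (T y) y) (inner ℝ (T (x - y)) x) (inner ℝ (T y) (x - y)),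
      h y hyN]
  nth_rw 1 [T.norm_eq_iSup_rayleighQuotient hT]
  refine ciSup_le fun x => ?_
  rcases eq_or_ne x 0 with rfl | hx
  · rw [T.rayleighQuotient_apply_zero, abs_zero]
    positivity
  rw [← T.rayleigh_smul x (inv_ne_zero (norm_ne_zero_iff.2 hx))]
  have hunit : ‖‖x‖⁻¹ • x‖ = 1 := norm_smul_inv_norm hx
  simpa [ContinuousLinearMap.rayleighQuotient, ContinuousLinearMap.reApplyInnerSelf, hunit] using
    hsphere _ (mem_sphere_zero_iff_norm.2 hunit)

theorem IsNearIsometryOn.univ_of_isCover [CompleteSpace V] [CompleteSpace F] {f : V →L[ℝ] F}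
    {δ : ℝ≥0} {N : Set V} (hN : N ⊆ sphere 0 1) (hcover : IsCover δ (sphere 0 1) N) {ε : ℝ}
    (hε : 0 ≤ ε) (hδ : (δ : ℝ) < 1 / 2) (h : IsNearIsometryOn ((1 - 2 * δ) * ε) f N) :
    IsNearIsometryOn ε f Set.univ := by
  set T : V →L[ℝ] V := f.adjoint ∘L f - .id ℝ V
  have hform (v : V) : inner ℝ (T v) v = ‖f v‖ ^ 2 - ‖v‖ ^ 2 := by
    simp [T, inner_sub_left, ContinuousLinearMap.adjoint_inner_left]
  have hT : T.IsSymmetric := by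
    intro v w
    simp [T, inner_sub_left, inner_sub_right, ContinuousLinearMap.adjoint_inner_left,
      ContinuousLinearMap.adjoint_inner_right]
  have hδ' : 0 < 1 - 2 * (δ : ℝ) := by linarith
  have hnorm : ‖T‖ ≤ ε := by
    have := norm_le_of_isCover hT hN hcover (mul_nonneg hδ'.le hε) fun y hy => by
      simpa [hform, mem_sphere_zero_iff_norm.1 (hN hy)] using h y hy
    exact le_of_mul_le_mul_left (by linarith) hδ'
  intro v _
  rw [← hform]
  calc |inner ℝ (T v) v| ≤ ‖T v‖ * ‖v‖ := abs_real_inner_le_norm _ _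
    _ ≤ ‖T‖ * ‖v‖ * ‖v‖ := by gcongr; exact T.le_opNorm _
    _ ≤ ε * ‖v‖ ^ 2 := by rw [mul_assoc, ← sq]; gcongr

end NearIsometry

section Subspace

variable {Ω ι : Type*} [MeasurableSpace Ω] {P : Measure Ω} [IsProbabilityMeasure P] {m : ℕ}
  {z : ι → Ω → EuclideanSpace ℝ (Fin m)} [Fintype ι]

theorem IsSpherical.ofReal_one_sub_le_measure_isNearIsometryOn_submodule (hz : IsSpherical P z)
    (V : Submodule ℝ (EuclideanSpace ℝ ι)) {ε δ : ℝ} (hε : 0 < ε) (hε1 : ε ≤ 2) (hδ : 0 < δ)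
    (hm : 64 * (ε ^ 2)⁻¹ * (Module.finrank ℝ V * Real.log 9 + Real.log (2 / δ)) ≤ m) :
    ENNReal.ofReal (1 - δ) ≤
      P {ω | IsNearIsometryOn ε (synthesis (z · ω)) (V : Set (EuclideanSpace ℝ ι))} := by
  obtain ⟨N, hN, hcover, hcard⟩ :=
    exists_isCover_card_le (E := V) (ε := 1 / 4) (by norm_num) Metric.sphere_subset_closedBall
  have hcard' : ((N.map (.subtype _)).card : ℝ) ≤ 9 ^ Module.finrank ℝ V := by
    rw [Finset.card_map]
    norm_num at hcard
    exact hcard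
  have hlog : Real.log (2 * 9 ^ Module.finrank ℝ V / δ) =
      Module.finrank ℝ V * Real.log 9 + Real.log (2 / δ) := by
    rw [mul_comm, mul_div_assoc, Real.log_mul (by positivity) (by positivity), Real.log_pow]
  refine (hz.ofReal_one_sub_le_measure_isNearIsometryOn_finset hcard' (t := ε / 2)
    (by positivity) (by linarith) hδ ?_).trans (measure_mono fun ω hω => ?_)
  · rw [hlog, div_pow, inv_div, div_eq_mul_inv, ← mul_assoc]
    norm_num only
    exact hm
  · have hquarter : (1 - 2 * ((1 / 4 : NNReal) : ℝ)) * ε = ε / 2 := by push_cast; ring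
    have hV : IsNearIsometryOn ε (synthesis (z · ω) ∘L V.subtypeL) Set.univ := by
      refine IsNearIsometryOn.univ_of_isCover hN hcover hε.le (by norm_num) fun v hv => ?_
      rw [hquarter]
      exact hω v (Finset.mem_map_of_mem _ hv)
    exact fun v hv => hV ⟨v, hv⟩ (Set.mem_univ _)

end Subspace

section Factor

theorem rpow_neg_half_mul_self {n : Type*} [Fintype n] [DecidableEq n] {A : Matrix n n ℝ}
    (hA : A.PosDef) : A ^ (-(1 / 2) : ℝ) * A ^ (-(1 / 2) : ℝ) = A⁻¹ := by
  have hinv := CFC.rpow_neg_one_eq_inv hA.isUnit.unit hA.posSemidef.nonneg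
  rw [IsUnit.unit_spec, Matrix.coe_units_inv, IsUnit.unit_spec] at hinv
  rw [← CFC.rpow_add hA.isUnit, ← neg_add, add_halves, hinv]

theorem transpose_rpow {n : Type*} [Fintype n] [DecidableEq n] (A : Matrix n n ℝ) (r : ℝ) :
    (A ^ r)ᵀ = A ^ r :=
  (conjTranspose_eq_transpose_of_trivial _).symm.trans
    (Matrix.nonneg_iff_posSemidef.1 CFC.rpow_nonneg).isHermitian

variable {d T : ℕ} {S₀ : Matrix (Fin d) (Fin d) ℝ} (σ : ℝ) (x : Fin T → EuclideanSpace ℝ (Fin d))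

theorem posDef_posteriorPrecision (hS₀ : S₀.PosDef) :
    (S₀⁻¹ + (1 / σ ^ 2) • ∑ t, vecMulVec (x t).ofLp (x t).ofLp).PosDef := by
  refine hS₀.inv.add_posSemidef (PosSemidef.smul (posSemidef_sum _ fun t _ => ?_) (by positivity))
  simpa using posSemidef_vecMulVec_self_star (x t).ofLp

theorem transpose_posteriorCov (hS₀ : S₀.PosDef) :
    (posteriorCov S₀ σ x)ᵀ = posteriorCov S₀ σ x :=
  (conjTranspose_eq_transpose_of_trivial _).symm.trans
    (posDef_posteriorPrecision σ x hS₀).inv.isHermitian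

variable (S₀) in
/-- The coefficients of `uᵀ A` with respect to the random vectors that `A` is built from. -/
noncomputable def factorCoeff :
    EuclideanSpace ℝ (Fin d) →ₗ[ℝ] EuclideanSpace ℝ (Fin d ⊕ Fin T) where
  toFun u := WithLp.toLp 2 (Sum.elim
    (S₀ ^ (-(1 / 2) : ℝ) *ᵥ (posteriorCov S₀ σ x *ᵥ u.ofLp))
    (fun t => 1 / σ * ((posteriorCov S₀ σ x *ᵥ u.ofLp) ⬝ᵥ (x t).ofLp)))
  map_add' u v := by
    ext i
    rcases i with i | t <;> simp [mulVec_add, add_dotProduct, mul_add]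
  map_smul' c u := by
    ext i
    rcases i with i | t <;> simp [mulVec_smul, smul_dotProduct, mul_left_comm]

theorem norm_factorCoeff_sq (hS₀ : S₀.PosDef) (u : EuclideanSpace ℝ (Fin d)) :
    ‖factorCoeff S₀ σ x u‖ ^ 2 = quadForm (posteriorCov S₀ σ x) u := by
  set w := posteriorCov S₀ σ x *ᵥ u.ofLp with hw
  set R := S₀ ^ (-(1 / 2) : ℝ)
  have hprecision : (S₀⁻¹ + (1 / σ ^ 2) • ∑ t, vecMulVec (x t).ofLp (x t).ofLp) *ᵥ w = u.ofLp := by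
    rw [hw, posteriorCov, mulVec_mulVec, mul_nonsing_inv _
      ((Matrix.isUnit_iff_isUnit_det _).1 (posDef_posteriorPrecision σ x hS₀).isUnit), one_mulVec]
  have hprior : (R *ᵥ w) ⬝ᵥ (R *ᵥ w) = (S₀⁻¹ *ᵥ w) ⬝ᵥ w := by
    rw [← rpow_neg_half_mul_self hS₀, dotProduct_mulVec, ← mulVec_transpose, transpose_rpow,
      mulVec_mulVec]
  calc ‖factorCoeff S₀ σ x u‖ ^ 2
      = (R *ᵥ w) ⬝ᵥ (R *ᵥ w) + ∑ t, (1 / σ * (w ⬝ᵥ (x t).ofLp)) ^ 2 := by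
        rw [EuclideanSpace.real_norm_sq_eq, Fintype.sum_sum_type]
        simp only [dotProduct, ← sq]
        rfl
    _ = (S₀⁻¹ *ᵥ w) ⬝ᵥ w + 1 / σ ^ 2 * ∑ t, (w ⬝ᵥ (x t).ofLp) ^ 2 := by
        simp only [hprior, mul_pow, Finset.mul_sum, one_div, inv_pow]
    _ = ((S₀⁻¹ + (1 / σ ^ 2) • ∑ t, vecMulVec (x t).ofLp (x t).ofLp) *ᵥ w) ⬝ᵥ w := by
        simp only [add_mulVec, add_dotProduct, smul_mulVec, smul_dotProduct, sum_mulVec,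
          sum_dotProduct, vecMulVec_mulVec, op_smul_eq_smul, dotProduct_comm w, smul_eq_mul, sq]
    _ = quadForm (posteriorCov S₀ σ x) u := by rw [hprecision, quadForm]

variable {M : ℕ} (Z : Fin d ⊕ Fin T → EuclideanSpace ℝ (Fin M))

theorem vecMul_factor (hS₀ : S₀.PosDef) (u : EuclideanSpace ℝ (Fin d)) :
    u.ofLp ᵥ* factor S₀ σ x (Z <| .inl ·) (Z <| .inr ·) =
      (synthesis Z (factorCoeff S₀ σ x u)).ofLp := by
  rw [factor, ← vecMul_vecMul, ← mulVec_transpose (posteriorCov S₀ σ x),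
    transpose_posteriorCov σ x hS₀, vecMul_add, ← vecMul_vecMul,
    ← mulVec_transpose (S₀ ^ (-(1 / 2) : ℝ)), transpose_rpow]
  ext j
  simp [synthesis_apply, factorCoeff, vecMul_smul, vecMul_sum, vecMul_vecMulVec, Finset.mul_sum,
    vecMul, dotProduct, mul_assoc, Finset.sum_mul]

theorem quadForm_mul_transpose {n m : ℕ} (A : Matrix (Fin n) (Fin m) ℝ)
    (u : EuclideanSpace ℝ (Fin n)) :
    quadForm (A * Aᵀ) u = ‖WithLp.toLp 2 (u.ofLp ᵥ* A)‖ ^ 2 := by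
  rw [quadForm, ← mulVec_mulVec, dotProduct_mulVec, mulVec_transpose,
    EuclideanSpace.real_norm_sq_eq]
  exact Finset.sum_congr rfl fun i _ => (sq _).symm

theorem isApproxFactorOn_iff (hS₀ : S₀.PosDef) {ε : ℝ} {𝒳 : Set (EuclideanSpace ℝ (Fin d))} :
    IsApproxFactorOn ε (posteriorCov S₀ σ x) (factor S₀ σ x (Z <| .inl ·) (Z <| .inr ·)) 𝒳 ↔
      IsNearIsometryOn ε (synthesis Z) (factorCoeff S₀ σ x '' 𝒳) := by
  rw [IsNearIsometryOn, Set.forall_mem_image]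
  refine forall₂_congr fun u _ => ?_
  rw [quadForm_mul_transpose, vecMul_factor σ x Z hS₀, norm_factorCoeff_sq σ x hS₀, abs_le]
  constructor <;> rintro ⟨hl, hu⟩ <;> constructor <;> linarith

end Factor

end Hypermodel

theorem mainTheorem6 {Ω : Type*} [MeasurableSpace Ω] (P : Measure Ω) [IsProbabilityMeasure P]
    (d T M : ℕ) (S₀ : Matrix (Fin d) (Fin d) ℝ) (hS₀ : S₀.PosDef) (σ : ℝ) (hσ : 0 < σ)
    (x : Fin T → EuclideanSpace ℝ (Fin d))
    (Z₀ : Fin d → Ω → EuclideanSpace ℝ (Fin M)) (z : Fin T → Ω → EuclideanSpace ℝ (Fin M))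
    (hz : Hypermodel.IsSpherical P (Sum.elim Z₀ z))
    (ε δ : ℝ) (hε : 0 < ε) (hε1 : ε < 1) (hδ : 0 < δ) (hδ1 : δ < 1) :
    (64 * (ε ^ 2)⁻¹ * (d * Real.log 9 + Real.log (2 / δ)) ≤ M →
      ENNReal.ofReal (1 - δ) ≤
        P {ω | Hypermodel.IsApproxFactorOn ε (Hypermodel.posteriorCov S₀ σ x)
          (Hypermodel.factor S₀ σ x (fun i => Z₀ i ω) (fun t => z t ω))
          (Metric.sphere (0 : EuclideanSpace ℝ (Fin d)) 1)}) ∧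
    (∀ 𝒳 : Finset (EuclideanSpace ℝ (Fin d)),
      64 * (ε ^ 2)⁻¹ * Real.log (2 * 𝒳.card / δ) ≤ M →
      ENNReal.ofReal (1 - δ) ≤
        P {ω | Hypermodel.IsApproxFactorOn ε (Hypermodel.posteriorCov S₀ σ x)
          (Hypermodel.factor S₀ σ x (fun i => Z₀ i ω) (fun t => z t ω))
          (𝒳 : Set (EuclideanSpace ℝ (Fin d)))}) := by
  classical
  set coeff := Hypermodel.factorCoeff S₀ σ x
  have hiff (ω : Ω) {𝒳 : Set (EuclideanSpace ℝ (Fin d))} := Hypermodel.isApproxFactorOn_iff σ x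
    (Sum.elim Z₀ z · ω) hS₀ (ε := ε) (𝒳 := 𝒳)
  constructor
  · intro hM
    have hrank : (Module.finrank ℝ (LinearMap.range coeff) : ℝ) ≤ d := by
      exact_mod_cast (LinearMap.finrank_range_le coeff).trans_eq finrank_euclideanSpace_fin
    refine (hz.ofReal_one_sub_le_measure_isNearIsometryOn_submodule (LinearMap.range coeff) hε
      (by linarith) hδ (hM.trans' (by gcongr))).trans
      (measure_mono fun ω hω => (hiff ω).2 fun v hv => hω v ?_)
    exact Set.image_subset_range _ _ hv
  · intro 𝒳 hM
    have hcard : ((𝒳.image coeff).card : ℝ) ≤ 𝒳.card := mod_cast Finset.card_image_le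
    refine (hz.ofReal_one_sub_le_measure_isNearIsometryOn_finset hcard hε hε1.le hδ
      (by linarith [Nat.cast_nonneg (α := ℝ) M])).trans
      (measure_mono fun ω hω => (hiff ω).2 ?_)
    rwa [Finset.coe_image] at hω
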